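/- Fix an integer $d\ge 1$ and $0<p<q\le\infty$. Let $|\cdot|$ be the Euclidean norm on $\mathbb R^d$. For a probability measure $\mu$ on $\mathbb R^d$ and an integer $N\ge1$ put \[ e_{N;d,p}(\mu)=\inf_{x_1,\dots,x_N\in\mathbb R^d}\mathcal W_p\Big(\mu,\frac1N\sum_{i=1}^N\delta_{x_i}\Big),\qquad \mathcal W_p(\mu,\nu)=\inf_{\gamma\in\Gamma(\mu,\nu)}\Big(\iint|x-y|^p\,\gamma(dx,dy)\Big)^{1/p}, \] where $\Gamma(\mu,\nu)$ is the set of probability measures on $\mathbb R^d\times\mathbb R^d$ with marginals $\mu$ and $\nu$. For $q<\infty$ let $\mathcal M_{q,\mathrm w}(\mu)=\sup_{\lambda\ge0}\lambda^q\mu(\{x\in\mathbb R^d:|x|\ge\lambda\})$; for $q=\infty$, $\mathcal M_{q,\mathrm w}(\mu)^{1/q}$ denotes the $\mu$-essential supremum of $|x|$, and we read $1/q=0$ and $\frac{pq}{q-p}=p$. Then there is a constant $C=C_{d,p,q}>0$ such that, for all $N\ge1$ and all probability measures $\mu$ on $\mathbb R^d$ with $\mathcal M_{q,\mathrm w}(\mu)^{1/q}<\infty$,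 \[ e_{N;d,p}(\mu)\le C\,\mathcal M_{q,\mathrm w}(\mu)^{1/q}\times \begin{cases} \max\{N^{-1/d},\,N^{-1/p+1/q}\} & \text{if } d\ne\frac{pq}{q-p},\\[2pt] N^{-1/d}\,\log(1+N)^{1/p} & \text{if } d=\frac{pq}{q-p}. \end{cases} \] -/

import Mathlib

open MeasureTheory
open scoped ENNReal NNReal

noncomputable section

/-- `Γ(μ, ν)`: the probability measures on `ℝᵈ × ℝᵈ` with first marginal `μ` and second
marginal `ν`. -/
def couplings {d : ℕ} (μ ν : Measure (EuclideanSpace ℝ (Fin d))) :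
    Set (Measure (EuclideanSpace ℝ (Fin d) × EuclideanSpace ℝ (Fin d))) :=
  {γ | IsProbabilityMeasure γ ∧ γ.map Prod.fst = μ ∧ γ.map Prod.snd = ν}

/-- The `p`-Wasserstein distance `inf_γ (∬ |x - y|^p γ(dx, dy))^(1/p)`, with values in `[0, ∞]`. -/
def wasserstein {d : ℕ} (p : ℝ) (μ ν : Measure (EuclideanSpace ℝ (Fin d))) : ℝ≥0∞ :=
  ⨅ γ ∈ couplings μ ν, (∫⁻ z, ‖z.1 - z.2‖ₑ ^ p ∂γ) ^ (1 / p)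

/-- The uniform discrete measure `(1/N) ∑ᵢ δ_{xᵢ}`. -/
def empiricalMeasure {d N : ℕ} (x : Fin N → EuclideanSpace ℝ (Fin d)) :
    Measure (EuclideanSpace ℝ (Fin d)) :=
  (N : ℝ≥0∞)⁻¹ • ∑ i, Measure.dirac (x i)

/-- The uniform quantization error `e_{N;d,p}(μ)`. -/
def quantError {d : ℕ} (N : ℕ) (p : ℝ) (μ : Measure (EuclideanSpace ℝ (Fin d))) : ℝ≥0∞ :=
  ⨅ x : Fin N → EuclideanSpace ℝ (Fin d), wasserstein p μ (empiricalMeasure x)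

/-- The weak moment `M_{q,w}(μ) = sup_{t ≥ 0} t^q μ(|x| ≥ t)`, for finite `q`. -/
def weakMoment {d : ℕ} (q : ℝ) (μ : Measure (EuclideanSpace ℝ (Fin d))) : ℝ≥0∞ :=
  ⨆ t : ℝ≥0, (t : ℝ≥0∞) ^ q * μ {x | (t : ℝ) ≤ ‖x‖}

/-- `M_{q,w}(μ)^(1/q)` for `0 < q ≤ ∞`; for `q = ∞` this is the essential supremum of `|x|`
(weak `L^∞` is `L^∞`). -/
def weakMomentRoot {d : ℕ} (q : ℝ≥0∞) (μ : Measure (EuclideanSpace ℝ (Fin d))) : ℝ≥0∞ :=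
  if q = ∞ then essSup (fun x => ‖x‖ₑ) μ else weakMoment q.toReal μ ^ (1 / q.toReal)

/-- The critical dimension `p q / (q - p)`, which is `p` for `q = ∞`. -/
def criticalDim (p : ℝ) (q : ℝ≥0∞) : ℝ :=
  if q = ∞ then p else p * q.toReal / (q.toReal - p)

end

/-! The atoms are placed by a single ordering of space that works at all scales. Space is cut into
dyadic annuli around the origin, starting from radius `R` slightly above the weak moment root. Each
annulus is subdivided into nested dyadic cells, and the cells are numbered by a Morton code, so
every coarser cell is an interval of codes. Cutting μ into N consecutive pieces of mass 1/N and
sending each piece to a point of the first cell it charges gives a coupling with an empirical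
measure. A cell of any level is then separated from its atoms on mass at most 1/N, because only the
piece straddling its left end can have its atom outside (`exists_coupling_empiricalMeasure`).

Two points first separated at level k, the transported one lying in annulus j, are at distance of
order R 2^(j-k). The mass so separated is at most the annulus mass and at most 2^(dk)/N, the annulus
having 2^(dk) cells. Hence the p-th power of the cost is bounded by R^p times `dyadicSum`
(`quantError_le_dyadicSum`), and a weak moment of order q gives annulus masses of order 2^(-qj).

The rest is a computation with this double series. Summing over levels first gives N^(-p/d) times a
geometric series in j, and summing over annuli first gives N^(-(1-p/q)) times a geometric series in
k. The two series converge exactly when p/d < 1-p/q and p/d > 1-p/q respectively. In the critical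
case about log N annuli contribute equally, which produces the logarithm. For q = ∞ only the central
ball is charged and d is compared with p. -/

/-! ### Equal-mass splitting and the ordered coupling -/

/-- A probability measure splits into `N` pieces of equal mass that are consecutive with respect
to a measurable labelling by natural numbers. -/
theorem exists_equal_mass_split {X : Type*} [MeasurableSpace X] (μ : Measure X)
    [IsProbabilityMeasure μ] {c : X → ℕ} (hc : Measurable c) {N : ℕ} (hN : 1 ≤ N) :
    ∃ (ν : Fin N → Measure X) (m : Fin N → ℕ), ∑ i, ν i = μ ∧
      (∀ i, ν i Set.univ = (N : ℝ≥0∞)⁻¹) ∧ (∀ i, μ (c ⁻¹' {m i}) ≠ 0) ∧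
      (∀ i, ν i {x | c x < m i} = 0) ∧ ∀ i i', i < i' → ν i {x | m i' < c x} = 0 := by
  have hN0 : (0 : ℝ) < N := by exact_mod_cast hN
  set F : ℕ → ℝ := fun n => μ.real {x | c x < n} with hF
  have hms : ∀ s : Set ℕ, MeasurableSet (c ⁻¹' s) := fun s => hc (MeasurableSet.of_discrete)
  have hF0 : F 0 = 0 := by simp [hF]
  have hFsucc : ∀ n, F (n + 1) = F n + μ.real (c ⁻¹' {n}) := by
    intro n
    have : {x | c x < n + 1} = {x | c x < n} ∪ c ⁻¹' {n} := by
      ext x; simp; omega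
    simp only [hF]
    rw [this, measureReal_union _ (hms _)]
    rw [Set.disjoint_left]; intro x hx hx'; simp at hx hx'; omega
  have hFmono : Monotone F := monotone_nat_of_le_succ fun n => by
    rw [hFsucc]; linarith [measureReal_nonneg (μ := μ) (s := c ⁻¹' {n})]
  have hFlim : Filter.Tendsto F Filter.atTop (nhds 1) := by
    have h1 : Filter.Tendsto (fun n : ℕ => μ {x | c x < n}) Filter.atTop
        (nhds (μ (⋃ n : ℕ, {x | c x < n}))) :=
      tendsto_measure_iUnion_atTop fun a b hab x hx => lt_of_lt_of_le hx hab
    have h2 : (⋃ n : ℕ, {x | c x < n}) = Set.univ := by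
      ext x; simp; exact ⟨c x + 1, by omega⟩
    rw [h2, measure_univ] at h1
    have := (ENNReal.tendsto_toReal ENNReal.one_ne_top).comp h1
    rw [ENNReal.toReal_one] at this
    exact this
  have hex : ∀ t : ℝ, t < 1 → ∃ n, t < F (n + 1) := by
    intro t ht
    obtain ⟨n, hn⟩ := (hFlim.eventually (lt_mem_nhds ht)).exists
    exact ⟨n, hn.trans_le (hFmono (Nat.le_succ n))⟩
  have hloc : ∀ t : ℝ, 0 ≤ t → t < 1 → ∃ n, F n ≤ t ∧ t < F (n + 1) := by
    intro t h0 h1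
    classical
    refine ⟨Nat.find (hex t h1), ?_, Nat.find_spec (hex t h1)⟩
    rcases hm : Nat.find (hex t h1) with _ | k
    · rw [hF0]; exact h0
    · exact not_lt.1 (Nat.find_min (hex t h1) (m := k) (by omega))
  -- Two tilings of [0, 1): by the masses of the labels, stacked in order, and by N equal intervals.
  -- Piece i takes from label n a share of mass equal to the overlap length `a n i`, so a heavy
  -- label may be divided among several pieces.
  set I : ℕ → Set ℝ := fun n => Set.Ico (F n) (F (n + 1)) with hI
  set J : Fin N → Set ℝ := fun i => Set.Ico ((i : ℝ) / N) (((i : ℝ) + 1) / N) with hJ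
  set a : ℕ → Fin N → ℝ≥0∞ := fun n i => volume (I n ∩ J i) with ha
  have hIsub : ∀ n, I n ⊆ Set.Ico 0 1 := by
    intro n t ht
    refine ⟨?_, ht.2.trans_le measureReal_le_one⟩
    exact (measureReal_nonneg).trans ht.1
  have hJsub : ∀ i, J i ⊆ Set.Ico 0 1 := by
    intro i t ht
    refine ⟨le_trans (by positivity) ht.1, ht.2.trans_le ?_⟩
    rw [div_le_one hN0]; exact_mod_cast i.2
  have hIU : ∀ t ∈ Set.Ico (0 : ℝ) 1, ∃ n, t ∈ I n := fun t ht => hloc t ht.1 ht.2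
  have hJU : ∀ t ∈ Set.Ico (0 : ℝ) 1, ∃ i, t ∈ J i := by
    intro t ht
    have h0 : 0 ≤ t * N := mul_nonneg ht.1 hN0.le
    refine ⟨⟨⌊t * N⌋₊, ?_⟩, ?_, ?_⟩
    · rw [Nat.floor_lt h0]; nlinarith [ht.2]
    · rw [div_le_iff₀ hN0]; exact Nat.floor_le h0
    · rw [lt_div_iff₀ hN0]; exact Nat.lt_floor_add_one _
  have hId : Pairwise (Function.onFun Disjoint I) := by
    simpa using hFmono.pairwise_disjoint_on_Ico_succ
  have hJd : Pairwise (Function.onFun Disjoint J) := by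
    intro i i' hii'
    wlog h : i < i' generalizing i i'
    · exact (this hii'.symm (lt_of_le_of_ne (not_lt.1 h) hii'.symm)).symm
    refine Set.disjoint_left.2 fun t ht ht' => ?_
    have h1 : ((i : ℝ) + 1) / N ≤ (i' : ℝ) / N := by
      gcongr; exact_mod_cast h
    linarith [ht.2, ht'.1]
  have hvolI : ∀ n, volume (I n) = μ (c ⁻¹' {n}) := by
    intro n
    simp only [hI, Real.volume_Ico, hFsucc, add_sub_cancel_left]
    exact ofReal_measureReal
  have hvolJ : ∀ i, volume (J i) = (N : ℝ≥0∞)⁻¹ := by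
    intro i
    simp only [hJ, Real.volume_Ico]
    rw [← sub_div, add_sub_cancel_left, one_div, ENNReal.ofReal_inv_of_pos hN0,
      ENNReal.ofReal_natCast]
  have hsumi : ∀ n, ∑ i, a n i = μ (c ⁻¹' {n}) := by
    intro n
    rw [← hvolI, ← tsum_fintype (L := .unconditional _), ← measure_iUnion]
    · congr 1
      rw [← Set.inter_iUnion]
      refine Set.inter_eq_left.2 fun t ht => Set.mem_iUnion.2 (hJU t (hIsub n ht))
    · intro i i' h
      exact (hJd h).mono Set.inter_subset_right Set.inter_subset_right
    · exact fun i => measurableSet_Ico.inter measurableSet_Ico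
  have hsumn : ∀ i, ∑' n, a n i = (N : ℝ≥0∞)⁻¹ := by
    intro i
    rw [← hvolJ i, ← measure_iUnion]
    · congr 1
      rw [← Set.iUnion_inter]
      refine Set.inter_eq_right.2 fun t ht => Set.mem_iUnion.2 (hIU t (hJsub i ht))
    · intro i i' h
      exact (hId h).mono Set.inter_subset_left Set.inter_subset_left
    · exact fun i => measurableSet_Ico.inter measurableSet_Ico
  have hmem : ∀ i : Fin N, (i : ℝ) / N ∈ Set.Ico (0 : ℝ) 1 := fun i =>
    ⟨by positivity, by rw [div_lt_one hN0]; exact_mod_cast i.2⟩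
  -- The label at the left endpoint i/N is the smallest one that piece i charges. It is also an
  -- upper bound for the labels of all earlier pieces.
  choose m hm using fun i => hIU _ (hmem i)
  have hane : ∀ n i, a n i ≠ 0 → ∃ t, t ∈ I n ∧ t ∈ J i := fun n i h =>
    nonempty_of_measure_ne_zero h
  have hale : ∀ n i, a n i ≤ μ (c ⁻¹' {n}) := fun n i => by
    rw [← hvolI]; exact measure_mono Set.inter_subset_left
  -- For a null label the inverse is ∞, but the overlap is 0 and so is the coefficient.
  set ν : Fin N → Measure X := fun i => Measure.sum fun n =>
    (a n i * (μ (c ⁻¹' {n}))⁻¹) • μ.restrict (c ⁻¹' {n}) with hν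
  have hνapp : ∀ i s, MeasurableSet s →
      ν i s = ∑' n, a n i * (μ (c ⁻¹' {n}))⁻¹ * μ (s ∩ c ⁻¹' {n}) := by
    intro i s hs
    simp only [hν]
    rw [Measure.sum_apply _ hs]
    simp [Measure.restrict_apply hs]
  refine ⟨ν, m, ?_, ?_, ?_, ?_, ?_⟩
  · ext s hs
    rw [Measure.finsetSum_apply]
    simp_rw [hνapp _ s hs]
    rw [← Summable.tsum_finsetSum (fun _ _ => ENNReal.summable)]
    have h1 : ∀ n, ∑ i, a n i * (μ (c ⁻¹' {n}))⁻¹ * μ (s ∩ c ⁻¹' {n}) = μ (s ∩ c ⁻¹' {n}) := by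
      intro n
      rw [← Finset.sum_mul, ← Finset.sum_mul, hsumi]
      by_cases h : μ (c ⁻¹' {n}) = 0
      · rw [h, measure_mono_null Set.inter_subset_right h, mul_zero]
      · rw [ENNReal.mul_inv_cancel h (measure_ne_top _ _), one_mul]
    simp_rw [h1]
    rw [← measure_iUnion]
    · congr 1
      ext x; simp
    · intro n n' h
      refine Set.disjoint_left.2 fun x hx hx' => h ?_
      rw [← show c x = n from hx.2, ← show c x = n' from hx'.2]
    · exact fun n => hs.inter (hms _)
  · intro i
    rw [hνapp i _ MeasurableSet.univ, ← hsumn i]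
    congr 1; ext n
    rw [Set.univ_inter]
    by_cases h : μ (c ⁻¹' {n}) = 0
    · rw [h, mul_zero]; exact (le_antisymm ((hale n i).trans h.le) bot_le).symm
    · rw [mul_assoc, ENNReal.inv_mul_cancel h (measure_ne_top _ _), mul_one]
  · intro i h
    have := hm i
    rw [← hvolI, hI, Real.volume_Ico, ENNReal.ofReal_eq_zero] at h
    linarith [this.1, this.2]
  · intro i
    change ν i (c ⁻¹' {n | n < m i}) = 0
    rw [hνapp i _ (hms _), ENNReal.tsum_eq_zero]
    intro n
    by_cases h : n < m i
    · have : a n i = 0 := by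
        by_contra h'
        obtain ⟨t, ht, ht'⟩ := hane n i h'
        have h1 := hFmono (Nat.succ_le_of_lt h)
        have h2 := (hm i).1
        simp only [Nat.succ_eq_add_one] at h1
        linarith [ht.2, ht'.1]
      rw [this, zero_mul, zero_mul]
    · have : c ⁻¹' {n | n < m i} ∩ c ⁻¹' {n} = ∅ := by
        ext x; simp; omega
      rw [this, measure_empty, mul_zero]
  · intro i i' hii'
    change ν i (c ⁻¹' {n | m i' < n}) = 0
    rw [hνapp i _ (hms _), ENNReal.tsum_eq_zero]
    intro n
    by_cases h : m i' < n
    · have : a n i = 0 := by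
        by_contra h'
        obtain ⟨t, ht, ht'⟩ := hane n i h'
        have h1 := hFmono (Nat.succ_le_of_lt h)
        have h2 := (hm i').2
        have h3 : ((i : ℝ) + 1) / N ≤ (i' : ℝ) / N := by
          gcongr; exact_mod_cast hii'
        simp only [Nat.succ_eq_add_one] at h1
        linarith [ht.1, ht'.2]
      rw [this, zero_mul, zero_mul]
    · have : c ⁻¹' {n | m i' < n} ∩ c ⁻¹' {n} = ∅ := by
        ext x; simp; omega
      rw [this, measure_empty, mul_zero]

/-- A coupling of `μ` with an empirical measure which separates the two points by a monotone
coarsening of the labelling `c` only with small probability. -/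
theorem exists_coupling_empiricalMeasure {d : ℕ} (μ : Measure (EuclideanSpace ℝ (Fin d)))
    [IsProbabilityMeasure μ] {c : EuclideanSpace ℝ (Fin d) → ℕ} (hc : Measurable c) {N : ℕ}
    (hN : 1 ≤ N) :
    ∃ y : Fin N → EuclideanSpace ℝ (Fin d), ∃ γ ∈ couplings μ (empiricalMeasure y),
      (∀ᵐ z ∂γ, c z.2 ≤ c z.1) ∧ ∀ g : ℕ → ℕ, Monotone g → ∀ w : ℕ,
        γ {z | g (c z.1) = w ∧ g (c z.2) ≠ w} ≤ (N : ℝ≥0∞)⁻¹ := by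
  obtain ⟨ν, m, hsum, hmass, hpos, hlo, hhi⟩ := exists_equal_mass_split μ hc hN
  have hms : ∀ s : Set ℕ, MeasurableSet (c ⁻¹' s) := fun s => hc (MeasurableSet.of_discrete)
  choose y hy using fun i => nonempty_of_measure_ne_zero (hpos i)
  have hy : ∀ i, c (y i) = m i := hy
  have hmeas : ∀ i, Measurable fun x : EuclideanSpace ℝ (Fin d) => (x, y i) := fun i =>
    measurable_id.prodMk measurable_const
  set γ : Measure (EuclideanSpace ℝ (Fin d) × EuclideanSpace ℝ (Fin d)) :=
    ∑ i, (ν i).map (fun x => (x, y i)) with hγ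
  have happ : ∀ s, MeasurableSet s → γ s = ∑ i, ν i {x | (x, y i) ∈ s} := by
    intro s hs
    rw [hγ, Measure.finsetSum_apply]
    exact Finset.sum_congr rfl fun i _ => Measure.map_apply (hmeas i) hs
  have hfst : γ.map Prod.fst = μ := by
    ext s hs
    rw [Measure.map_apply measurable_fst hs, happ _ (measurable_fst hs)]
    conv_rhs => rw [← hsum, Measure.finsetSum_apply]
    rfl
  have hsnd : γ.map Prod.snd = empiricalMeasure y := by
    ext s hs
    rw [Measure.map_apply measurable_snd hs, happ _ (measurable_snd hs), empiricalMeasure,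
      Measure.smul_apply, Measure.finsetSum_apply, smul_eq_mul, Finset.mul_sum]
    refine Finset.sum_congr rfl fun i _ => ?_
    rw [Measure.dirac_apply' _ hs]
    by_cases h : y i ∈ s <;> simp [h, hmass]
  have hprob : IsProbabilityMeasure γ := by
    refine ⟨?_⟩
    rw [← Set.preimage_univ (f := Prod.fst), ← Measure.map_apply measurable_fst MeasurableSet.univ,
      hfst, measure_univ]
  refine ⟨y, γ, ⟨hprob, hfst, hsnd⟩, ?_, ?_⟩
  · rw [ae_iff, happ]
    · refine Finset.sum_eq_zero fun i _ => ?_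
      simpa [hy] using hlo i
    · simp only [not_le]
      exact measurableSet_lt (hc.comp measurable_fst) (hc.comp measurable_snd)
  · intro g hg w
    have hgm : Measurable g := Measurable.of_discrete
    rw [happ]
    · simp only [Set.mem_ofPred_eq, hy]
      by_cases hall : ∀ i, ν i {x | g (c x) = w ∧ g (m i) ≠ w} = 0
      · simp [hall]
      push Not at hall
      obtain ⟨i₀, hi₀⟩ := hall
      -- At most one piece can be separated from its atom by the coarse cell w. For i < i', charged
      -- labels c x ≤ m i' ≤ c x' that both map to w under the monotone g squeeze g (m i') to w.
      have key : ∀ i i', i < i' → ν i {x | g (c x) = w ∧ g (m i) ≠ w} ≠ 0 →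
          ν i' {x | g (c x) = w ∧ g (m i') ≠ w} = 0 := by
        intro i i' hii' h
        by_contra h'
        have aux : ∀ k, ν k {x | g (c x) = w ∧ g (m k) ≠ w} ≠ 0 → ∀ s : Set ℕ,
            ν k (c ⁻¹' s) = 0 → ∃ x, g (c x) = w ∧ g (m k) ≠ w ∧ c x ∉ s := by
          intro k hk s hs
          by_contra! hcon
          exact hk (measure_mono_null (fun x hx => hcon x hx.1 hx.2) hs)
        obtain ⟨x, hx1, -, hx3⟩ := aux i h {n | m i' < n} (hhi i i' hii')
        obtain ⟨x', hx'1, hx'2, hx'3⟩ := aux i' h' {n | n < m i'} (hlo i')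
        have h1 := hg (not_lt.1 hx3)
        have h2 := hg (not_lt.1 hx'3)
        omega
      rw [Finset.sum_eq_single i₀]
      · exact (measure_mono (Set.subset_univ _)).trans (hmass i₀).le
      · intro i _ hi
        rcases lt_or_gt_of_ne hi with h | h
        · by_contra h'
          exact hi₀ (key i i₀ h h')
        · exact key i₀ i h hi₀
      · simp
    · exact (measurableSet_eq_fun (hgm.comp (hc.comp measurable_fst)) measurable_const).inter
        (measurableSet_eq_fun (hgm.comp (hc.comp measurable_snd)) measurable_const).compl

/-! ### Annuli, dyadic cells and Morton codes -/

/-- The index `j` of the dyadic annulus `R 2^(j-1) < ‖x‖ ≤ R 2^j` (a ball for `j = 0`)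
containing `x`. -/
noncomputable def radialIndex {d : ℕ} (R : ℝ) (x : EuclideanSpace ℝ (Fin d)) : ℕ :=
  ⌈Real.logb 2 (‖x‖ / R)⌉₊

theorem measurable_radialIndex {d : ℕ} (R : ℝ) :
    Measurable (radialIndex (d := d) R) := by
  unfold radialIndex
  refine Nat.measurable_ceil.comp ?_
  unfold Real.logb
  fun_prop

theorem norm_le_of_radialIndex {d : ℕ} {R : ℝ} (hR : 0 < R) (x : EuclideanSpace ℝ (Fin d)) :
    ‖x‖ ≤ R * 2 ^ radialIndex R x := by
  rcases eq_or_lt_of_le (norm_nonneg x) with h | h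
  · rw [← h]; positivity
  · have h1 : Real.logb 2 (‖x‖ / R) ≤ (radialIndex R x : ℝ) := Nat.le_ceil _
    rw [Real.logb_le_iff_le_rpow (by norm_num) (by positivity), Real.rpow_natCast,
      div_le_iff₀ hR] at h1
    linarith

theorem lt_norm_of_lt_radialIndex {d : ℕ} {R : ℝ} (hR : 0 < R)
    {x : EuclideanSpace ℝ (Fin d)} {j : ℕ} (hj : j < radialIndex R x) : R * 2 ^ j < ‖x‖ := by
  have h1 : (j : ℝ) < Real.logb 2 (‖x‖ / R) := Nat.lt_ceil.1 hj
  have hx : 0 < ‖x‖ := by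
    rcases eq_or_lt_of_le (norm_nonneg x) with h | h
    · rw [← h] at h1
      simp at h1
      linarith [Nat.cast_nonneg (α := ℝ) j]
    · exact h
  rw [Real.lt_logb_iff_rpow_lt (by norm_num) (by positivity), Real.rpow_natCast,
    lt_div_iff₀ hR] at h1
  linarith

/-- The coordinates of `x` rescaled so that its annulus lands in `[0, 1)ᵈ`. -/
noncomputable def cellCoord {d : ℕ} (R : ℝ) (x : EuclideanSpace ℝ (Fin d)) (i : Fin d) : ℝ :=
  x i / (4 * R * 2 ^ radialIndex R x) + 1 / 2

theorem measurable_cellCoord {d : ℕ} (R : ℝ) (i : Fin d) :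
    Measurable fun x : EuclideanSpace ℝ (Fin d) => cellCoord R x i := by
  unfold cellCoord
  have h := measurable_radialIndex (d := d) R
  have h2 : Measurable fun x : EuclideanSpace ℝ (Fin d) => (2 : ℝ) ^ radialIndex R x :=
    (Measurable.of_discrete (f := fun n : ℕ => (2 : ℝ) ^ n)).comp h
  fun_prop

theorem cellCoord_mem_Ico {d : ℕ} {R : ℝ} (hR : 0 < R) (x : EuclideanSpace ℝ (Fin d))
    (i : Fin d) : cellCoord R x i ∈ Set.Ico (0 : ℝ) 1 := by
  have h1 : |x i| ≤ R * 2 ^ radialIndex R x :=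
    (PiLp.norm_apply_le x i).trans (norm_le_of_radialIndex hR x)
  have h2 : 0 < R * 2 ^ radialIndex R x := by positivity
  have h3 : |x i / (4 * R * 2 ^ radialIndex R x)| ≤ 1 / 4 := by
    rw [abs_div, abs_of_pos (by positivity : 0 < 4 * R * 2 ^ radialIndex R x),
      div_le_iff₀ (by positivity)]
    linarith
  rw [abs_le] at h3
  unfold cellCoord
  constructor <;> linarith [h3.1, h3.2]

/-- The vector of `k`-th binary digits of the rescaled coordinates, as a number below `2^d`. -/
noncomputable def cellDigit {d : ℕ} (R : ℝ) (k : ℕ) (x : EuclideanSpace ℝ (Fin d)) :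
    Fin (2 ^ d) :=
  finFunctionFinEquiv fun i => ⟨⌊2 ^ k * cellCoord R x i⌋₊ % 2, Nat.mod_lt _ two_pos⟩

/-- The Morton code of the dyadic cell of level `k` containing `x`; each annulus is subdivided
into `2^(dk)` cells. -/
noncomputable def cellCode {d : ℕ} (R : ℝ) : ℕ → EuclideanSpace ℝ (Fin d) → ℕ
  | 0, x => radialIndex R x
  | k + 1, x => 2 ^ d * cellCode R k x + cellDigit R (k + 1) x

theorem measurable_cellDigit {d : ℕ} (R : ℝ) (k : ℕ) :
    Measurable (cellDigit (d := d) R k) := by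
  unfold cellDigit
  refine Measurable.of_discrete.comp (measurable_pi_lambda _ fun i => ?_)
  have h : Measurable fun x : EuclideanSpace ℝ (Fin d) => ⌊2 ^ k * cellCoord R x i⌋₊ :=
    Nat.measurable_floor.comp ((measurable_cellCoord R i).const_mul _)
  exact (Measurable.of_discrete
    (f := fun n : ℕ => (⟨n % 2, Nat.mod_lt _ two_pos⟩ : Fin 2))).comp h

theorem measurable_cellCode {d : ℕ} (R : ℝ) (k : ℕ) : Measurable (cellCode (d := d) R k) := by
  induction k with
  | zero => exact measurable_radialIndex R
  | succ k ih =>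
    have h : Measurable fun x : EuclideanSpace ℝ (Fin d) => (cellDigit R (k + 1) x : ℕ) :=
      Measurable.of_discrete.comp (measurable_cellDigit R (k + 1))
    exact (ih.const_mul _).add h

theorem cellCode_succ_div {d : ℕ} (R : ℝ) (k : ℕ) (x : EuclideanSpace ℝ (Fin d)) :
    cellCode R (k + 1) x / 2 ^ d = cellCode R k x := by
  rw [cellCode, Nat.mul_add_div (by positivity), Nat.div_eq_of_lt (Fin.is_lt _), add_zero]

/-- Dividing by a power of 2^d drops the finest digits. This is a monotone coarsening, so one
ordering by the finest code serves all coarser levels. -/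
theorem cellCode_add_div {d : ℕ} (R : ℝ) (k l : ℕ) (x : EuclideanSpace ℝ (Fin d)) :
    cellCode R (k + l) x / (2 ^ d) ^ l = cellCode R k x := by
  induction l with
  | zero => simp
  | succ l ih =>
    rw [pow_succ', ← Nat.div_div_eq_div_mul, ← add_assoc, cellCode_succ_div, ih]

theorem radialIndex_eq_cellCode_div {d : ℕ} (R : ℝ) (k : ℕ) (x : EuclideanSpace ℝ (Fin d)) :
    cellCode R k x / (2 ^ d) ^ k = radialIndex R x := by
  have := cellCode_add_div R 0 k x
  rwa [zero_add] at this

/-- Induction on the level: the parent floors agree, being the halves of the child floors, and the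
last digit restores the parity. At level 0 all floors vanish because the rescaled coordinates lie in
[0, 1). -/
theorem floor_cellCoord_eq {d : ℕ} {R : ℝ} (hR : 0 < R) {k : ℕ}
    {x y : EuclideanSpace ℝ (Fin d)} (h : cellCode R k x = cellCode R k y) (i : Fin d) :
    ⌊2 ^ k * cellCoord R x i⌋₊ = ⌊2 ^ k * cellCoord R y i⌋₊ := by
  induction k with
  | zero =>
    have hx := cellCoord_mem_Ico hR x i
    have hy := cellCoord_mem_Ico hR y i
    rw [pow_zero, one_mul, one_mul, Nat.floor_eq_zero.2 hx.2, Nat.floor_eq_zero.2 hy.2]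
  | succ k ih =>
    have h1 : cellCode R k x = cellCode R k y := by
      rw [← cellCode_succ_div, h, cellCode_succ_div]
    have h2 : cellDigit R (k + 1) x = cellDigit R (k + 1) y := by
      rw [cellCode, cellCode, h1] at h
      exact Fin.ext (by omega)
    have h3 := congrFun (finFunctionFinEquiv.injective h2) i
    simp only [Fin.mk.injEq] at h3
    have h4 : ∀ u : ℝ, ⌊2 ^ k * u⌋₊ = ⌊2 ^ (k + 1) * u⌋₊ / 2 := by
      intro u
      have := Nat.floor_div_natCast (2 ^ (k + 1) * u) 2
      rw [← this]
      congr 1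
      push_cast
      ring
    have h5 := ih h1
    rw [h4, h4] at h5
    omega

/-- Equal codes force the same annulus and the same floors, so each coordinate differs by at most
the cell side. The factor d is a crude substitute for √d. -/
theorem norm_sub_le_of_cellCode_eq {d : ℕ} {R : ℝ} (hR : 0 < R) {k : ℕ}
    {x y : EuclideanSpace ℝ (Fin d)} (h : cellCode R k x = cellCode R k y) :
    ‖x - y‖ ≤ 4 * d * R * 2 ^ radialIndex R x / 2 ^ k := by
  have hj : radialIndex R x = radialIndex R y := by
    rw [← radialIndex_eq_cellCode_div R k x, h, radialIndex_eq_cellCode_div]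
  have hcoord : ∀ i, |x i - y i| ≤ 4 * R * 2 ^ radialIndex R x / 2 ^ k := by
    intro i
    have hf := floor_cellCoord_eq hR h i
    have hx := cellCoord_mem_Ico hR x i
    have hy := cellCoord_mem_Ico hR y i
    have h2k : (0 : ℝ) < 2 ^ k := by positivity
    have hx1 := Nat.floor_le (mul_nonneg h2k.le hx.1)
    have hy1 := Nat.floor_le (mul_nonneg h2k.le hy.1)
    have hx2 := Nat.lt_floor_add_one (2 ^ k * cellCoord R x i)
    have hy2 := Nat.lt_floor_add_one (2 ^ k * cellCoord R y i)
    rw [hf] at hx1 hx2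
    have h1 : |2 ^ k * (cellCoord R x i - cellCoord R y i)| ≤ 1 := by
      rw [abs_le]; constructor <;> nlinarith
    have hB : 0 < 4 * R * 2 ^ radialIndex R x := by positivity
    have h2 : x i - y i =
        4 * R * 2 ^ radialIndex R x * (cellCoord R x i - cellCoord R y i) := by
      unfold cellCoord
      rw [← hj]
      field_simp
      ring
    rw [abs_mul, abs_of_pos h2k] at h1
    rw [h2, abs_mul, abs_of_pos hB, le_div_iff₀ h2k]
    nlinarith [abs_nonneg (cellCoord R x i - cellCoord R y i)]
  set B := 4 * R * 2 ^ radialIndex R x / 2 ^ k with hBdef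
  have hB0 : 0 ≤ B := by positivity
  have hsq : ‖x - y‖ ^ 2 ≤ (d * B) ^ 2 := by
    rw [EuclideanSpace.norm_sq_eq]
    calc ∑ i, ‖(x - y) i‖ ^ 2 ≤ ∑ _i : Fin d, B ^ 2 := by
          refine Finset.sum_le_sum fun i _ => ?_
          have : ‖(x - y) i‖ = |x i - y i| := by simp
          rw [this]
          exact pow_le_pow_left₀ (abs_nonneg _) (hcoord i) 2
      _ = d * B ^ 2 := by simp
      _ ≤ (d * B) ^ 2 := by
          rw [mul_pow]
          refine mul_le_mul_of_nonneg_right ?_ (sq_nonneg B)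
          exact_mod_cast Nat.le_self_pow two_ne_zero d
  have := abs_le_of_sq_le_sq hsq (by positivity)
  calc ‖x - y‖ ≤ d * B := (le_abs_self _).trans this
    _ = _ := by rw [hBdef]; ring

/-! ### Transport cost and the dyadic sum -/

/-- The sum over annuli `j` and levels `k` controlling the transport cost when the annuli have
masses `w j`. -/
noncomputable def dyadicSum (d N : ℕ) (p : ℝ) (w : ℕ → ℝ≥0∞) : ℝ≥0∞ :=
  ∑' j : ℕ, ∑' k : ℕ,
    ENNReal.ofReal (2 ^ (((j : ℝ) - k) * p)) * min (w j) (((2 : ℝ≥0∞) ^ d) ^ k / N)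

theorem enorm_rpow_le_of_norm_le {E : Type*} [SeminormedAddCommGroup E] {p B : ℝ} {j k : ℕ}
    (hp : 0 < p) (hB : 0 ≤ B) {v : E} (h : ‖v‖ ≤ B * 2 ^ j / 2 ^ k) :
    ‖v‖ₑ ^ p ≤ ENNReal.ofReal (B ^ p) * ENNReal.ofReal (2 ^ (((j : ℝ) - k) * p)) := by
  rw [← ofReal_norm, ENNReal.ofReal_rpow_of_nonneg (norm_nonneg _) hp.le,
    ← ENNReal.ofReal_mul (by positivity)]
  refine ENNReal.ofReal_le_ofReal ?_
  have h1 : (2 : ℝ) ^ (((j : ℝ) - k) * p) = (2 ^ j / 2 ^ k) ^ p := by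
    rw [Real.rpow_mul (by norm_num), Real.rpow_sub (by norm_num), Real.rpow_natCast,
      Real.rpow_natCast]
  rw [h1, ← Real.mul_rpow hB (by positivity), ← mul_div_assoc]
  exact Real.rpow_le_rpow (norm_nonneg _) h hp.le

/-- Points are close at the scale given by the first level at which their cells differ. -/
theorem exists_level_norm_sub_le {d : ℕ} (hd : 1 ≤ d) {R : ℝ} (hR : 0 < R) (K : ℕ)
    {x y : EuclideanSpace ℝ (Fin d)} (hxy : cellCode R K y ≤ cellCode R K x) :
    (∃ k ≤ K, cellCode R k x ≠ cellCode R k y ∧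
      ‖x - y‖ ≤ 8 * d * R * 2 ^ radialIndex R x / 2 ^ k) ∨
      ‖x - y‖ ≤ 8 * d * R * 2 ^ radialIndex R x / 2 ^ K := by
  have hd' : (1 : ℝ) ≤ d := by exact_mod_cast hd
  by_cases hall : ∃ k, k ≤ K ∧ cellCode R k x ≠ cellCode R k y
  · left
    classical
    obtain ⟨h1, h2⟩ := Nat.find_spec hall
    refine ⟨Nat.find hall, h1, h2, ?_⟩
    -- If level 0 already separates the points, the ordering of codes places y in an inner annulus,
    -- so both norms are controlled by the annulus of x. Otherwise the points share the cell one
    -- level up, which doubles the constant 4 to 8.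
    rcases hk : Nat.find hall with _ | k
    · have hj : radialIndex R y ≤ radialIndex R x := by
        rw [← radialIndex_eq_cellCode_div R K x, ← radialIndex_eq_cellCode_div R K y]
        exact Nat.div_le_div_right hxy
      have hx := norm_le_of_radialIndex hR x
      have hy := norm_le_of_radialIndex hR y
      have hj' : R * (2 : ℝ) ^ radialIndex R y ≤ R * 2 ^ radialIndex R x :=
        mul_le_mul_of_nonneg_left (pow_le_pow_right₀ (by norm_num) hj) hR.le
      have h0 : 0 < R * (2 : ℝ) ^ radialIndex R x := by positivity
      rw [pow_zero, div_one]
      nlinarith [norm_sub_le x y]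
    · have hmin := Nat.find_min hall (m := k) (by omega)
      have heq : cellCode R k x = cellCode R k y := by
        by_contra hne
        exact hmin ⟨by omega, hne⟩
      refine (norm_sub_le_of_cellCode_eq hR heq).trans (le_of_eq ?_)
      rw [pow_succ]
      field_simp
      ring
  · right
    push Not at hall
    refine (norm_sub_le_of_cellCode_eq hR (hall K le_rfl)).trans ?_
    gcongr
    norm_num

theorem quantError_le_dyadicSum {d : ℕ} (hd : 1 ≤ d) {p : ℝ} (hp : 0 < p) {N : ℕ} (hN : 1 ≤ N)
    {R : ℝ} (hR : 0 < R) (μ : Measure (EuclideanSpace ℝ (Fin d))) [IsProbabilityMeasure μ]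
    {A : ℝ≥0∞} (hA : 1 ≤ A) {w : ℕ → ℝ≥0∞} (hw : ∀ j, w j ≤ 1)
    (hμ : ∀ j, μ {x | radialIndex R x = j} ≤ A * w j) :
    quantError N p μ ≤
      (2 * ENNReal.ofReal ((8 * d * R) ^ p) * A * dyadicSum d N p w) ^ (1 / p) := by
  obtain ⟨y, γ, hγ, hle, hsep⟩ :=
    exists_coupling_empiricalMeasure μ (measurable_cellCode (d := d) R N) hN
  refine (iInf_le _ y).trans ((iInf₂_le γ hγ).trans ?_)
  refine ENNReal.rpow_le_rpow ?_ (by positivity)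
  obtain ⟨hγp, hγ1, hγ2⟩ := hγ
  set f : ℕ → ℕ → ℝ≥0∞ := fun j k => ENNReal.ofReal (2 ^ (((j : ℝ) - k) * p)) with hf
  set D : ℝ≥0∞ := ENNReal.ofReal ((8 * d * R) ^ p) with hD
  set T : ℕ → Set (EuclideanSpace ℝ (Fin d) × EuclideanSpace ℝ (Fin d)) :=
    fun j => {z | radialIndex R z.1 = j} with hT
  set S : ℕ → ℕ → Set (EuclideanSpace ℝ (Fin d) × EuclideanSpace ℝ (Fin d)) :=
    fun j k => {z | k ≤ N ∧ radialIndex R z.1 = j ∧ cellCode R k z.1 ≠ cellCode R k z.2} with hS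
  have hc1 : ∀ k, Measurable fun z : EuclideanSpace ℝ (Fin d) × EuclideanSpace ℝ (Fin d) =>
      cellCode R k z.1 := fun k => (measurable_cellCode R k).comp measurable_fst
  have hc2 : ∀ k, Measurable fun z : EuclideanSpace ℝ (Fin d) × EuclideanSpace ℝ (Fin d) =>
      cellCode R k z.2 := fun k => (measurable_cellCode R k).comp measurable_snd
  have hTm : ∀ j, MeasurableSet (T j) := fun j =>
    measurableSet_eq_fun ((measurable_radialIndex R).comp measurable_fst) measurable_const
  have hSm : ∀ j k, MeasurableSet (S j k) := fun j k =>
    (MeasurableSet.const _).inter ((hTm j).inter (measurableSet_eq_fun (hc1 k) (hc2 k)).compl)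
  have hγT : ∀ j, γ (T j) ≤ A * w j := by
    intro j
    refine le_trans (le_of_eq ?_) (hμ j)
    rw [← hγ1, Measure.map_apply measurable_fst]
    · rfl
    · exact measurableSet_eq_fun (measurable_radialIndex R) measurable_const
  have hNne : (N : ℝ≥0∞) ≠ 0 := by simp; omega
  have hγS : ∀ j k, γ (S j k) ≤ A * min (w j) (((2 : ℝ≥0∞) ^ d) ^ k / N) := by
    intro j k
    rw [mul_min]
    refine le_min ((measure_mono fun z hz => hz.2.1).trans (hγT j)) ?_
    refine le_trans ?_ (le_mul_of_one_le_left' hA)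
    by_cases hk : k ≤ N
    -- The codes of level k inside annulus j form an interval of (2^d)^k integers, each losing at
    -- most 1/N.
    · have hcov : S j k ⊆ ⋃ v ∈ Finset.Ico (j * (2 ^ d) ^ k) ((j + 1) * (2 ^ d) ^ k),
          {z | cellCode R k z.1 = v ∧ cellCode R k z.2 ≠ v} := by
        rintro z ⟨-, hz1, hz2⟩
        simp only [Set.mem_iUnion, exists_prop]
        refine ⟨cellCode R k z.1, ?_, rfl, hz2.symm⟩
        rw [← radialIndex_eq_cellCode_div R k, Nat.div_eq_iff (by positivity)] at hz1
        have : 0 < (2 ^ d) ^ k := by positivity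
        rw [Finset.mem_Ico, add_mul, one_mul]
        omega
      refine (measure_mono hcov).trans ((measure_biUnion_finset_le _ _).trans ?_)
      have hone : ∀ v, γ {z | cellCode R k z.1 = v ∧ cellCode R k z.2 ≠ v} ≤ (N : ℝ≥0∞)⁻¹ := by
        intro v
        have h := hsep (fun n => n / (2 ^ d) ^ (N - k)) (fun a b h => Nat.div_le_div_right h) v
        have hcode : ∀ x, cellCode R N x / (2 ^ d) ^ (N - k) = cellCode (d := d) R k x := by
          intro x
          have := cellCode_add_div R k (N - k) x
          rwa [Nat.add_sub_cancel' hk] at this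
        simpa only [hcode] using h
      refine (Finset.sum_le_sum fun v _ => hone v).trans (le_of_eq ?_)
      rw [Finset.sum_const, Nat.card_Ico, add_mul, one_mul, Nat.add_sub_cancel_left,
        nsmul_eq_mul, ENNReal.div_eq_inv_mul, mul_comm]
      push_cast
      rfl
    · have : S j k = ∅ := by
        ext z; simp [hS, hk]
      rw [this, measure_empty]; exact zero_le
  -- Truncation at level N suffices: since N ≤ 2^(dN), the second entry of the minimum is at least 1
  -- there. The mass never separated is thus paid for by the k = N term of the dyadic sum.
  have hγT' : ∀ j, γ (T j) ≤ A * min (w j) (((2 : ℝ≥0∞) ^ d) ^ N / N) := by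
    intro j
    refine (hγT j).trans (mul_le_mul_right (le_min le_rfl ((hw j).trans ?_)) A)
    rw [ENNReal.le_div_iff_mul_le (Or.inl hNne) (Or.inl (ENNReal.natCast_ne_top N)), one_mul]
    have : N ≤ (2 ^ d) ^ N :=
      (Nat.lt_pow_self (lt_of_lt_of_le one_lt_two (Nat.le_self_pow (by omega) 2))).le
    exact_mod_cast this
  have hpt : ∀ᵐ z ∂γ, ‖z.1 - z.2‖ₑ ^ p ≤
      (∑' j, ∑' k, (S j k).indicator (fun _ => D * f j k) z) +
        ∑' j, (T j).indicator (fun _ => D * f j N) z := by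
    filter_upwards [hle] with z hz
    rcases exists_level_norm_sub_le hd hR N hz with ⟨k, hk, hne, hk'⟩ | h
    · refine le_add_right ((enorm_rpow_le_of_norm_le hp (by positivity) hk').trans ?_)
      refine le_trans ?_ ((ENNReal.le_tsum k).trans (ENNReal.le_tsum (radialIndex R z.1)))
      rw [Set.indicator_of_mem]
      exact ⟨hk, rfl, hne⟩
    · refine le_add_left ((enorm_rpow_le_of_norm_le hp (by positivity) h).trans ?_)
      refine le_trans ?_ (ENNReal.le_tsum (radialIndex R z.1))
      rw [Set.indicator_of_mem]
      exact rfl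
  calc ∫⁻ z, ‖z.1 - z.2‖ₑ ^ p ∂γ
      ≤ ∫⁻ z, (∑' j, ∑' k, (S j k).indicator (fun _ => D * f j k) z) +
        ∑' j, (T j).indicator (fun _ => D * f j N) z ∂γ := lintegral_mono_ae hpt
    _ = (∑' j, ∑' k, D * f j k * γ (S j k)) + ∑' j, D * f j N * γ (T j) := by
        have hSi : ∀ j k, Measurable ((S j k).indicator fun _ => D * f j k) := fun j k =>
          measurable_const.indicator (hSm j k)
        have hTi : ∀ j, Measurable ((T j).indicator fun _ => D * f j N) := fun j =>
          measurable_const.indicator (hTm j)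
        rw [lintegral_add_right _ (Measurable.tsum hTi),
          lintegral_tsum fun j => (Measurable.tsum (hSi j)).aemeasurable,
          lintegral_tsum fun j => (hTi j).aemeasurable]
        congr 1
        · refine tsum_congr fun j => ?_
          rw [lintegral_tsum fun k => (hSi j k).aemeasurable]
          exact tsum_congr fun k => lintegral_indicator_const (hSm j k) _
        · exact tsum_congr fun j => lintegral_indicator_const (hTm j) _
    _ ≤ D * A * dyadicSum d N p w + D * A * dyadicSum d N p w := by
        unfold dyadicSum
        simp_rw [← ENNReal.tsum_mul_left]
        refine add_le_add ?_ ?_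
        · refine ENNReal.tsum_le_tsum fun j => ENNReal.tsum_le_tsum fun k => ?_
          refine (mul_le_mul_right (hγS j k) _).trans (le_of_eq ?_)
          simp only [hf]; ring
        · refine ENNReal.tsum_le_tsum fun j => ?_
          refine le_trans ?_ (ENNReal.le_tsum N)
          refine (mul_le_mul_right (hγT' j) _).trans (le_of_eq ?_)
          simp only [hf]; ring
    _ = 2 * D * A * dyadicSum d N p w := by ring

/-! ### Estimates of the dyadic sum for finite q -/

theorem exists_tsum_two_rpow_neg_abs_le {c : ℝ} (hc : 0 < c) :
    ∃ C : ℝ, 0 < C ∧ ∀ z : ℝ,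
      ∑' k : ℕ, ENNReal.ofReal (2 ^ (-(c * |(k : ℝ) - z|))) ≤ ENNReal.ofReal C := by
  -- The factor 2^c absorbs replacing z by its floor. Extending the sum to ℤ then makes it
  -- translation invariant, hence uniform in z.
  set h : ℤ → ℝ := fun k => 2 ^ c * 2 ^ (-(c * |(k : ℝ)|)) with hh
  have hpos : ∀ k, 0 < h k := fun k => by positivity
  have hgeo : Summable fun n : ℕ => (2 : ℝ) ^ c * 2 ^ (-(c * (n : ℝ))) := by
    refine Summable.mul_left _ ?_
    have : (fun n : ℕ => (2 : ℝ) ^ (-(c * (n : ℝ)))) = fun n : ℕ => ((2 : ℝ) ^ (-c)) ^ n := by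
      ext n
      rw [← Real.rpow_natCast, ← Real.rpow_mul (by norm_num), neg_mul]
    rw [this]
    exact summable_geometric_of_lt_one (by positivity)
      (Real.rpow_lt_one_of_one_lt_of_neg (by norm_num) (by linarith))
  have hsum : Summable h := by
    refine Summable.of_nat_of_neg ?_ ?_ <;> simpa [hh] using hgeo
  refine ⟨∑' k, h k, hsum.tsum_pos (fun k => (hpos k).le) 0 (hpos 0), fun z => ?_⟩
  calc ∑' k : ℕ, ENNReal.ofReal (2 ^ (-(c * |(k : ℝ) - z|)))
      ≤ ∑' k : ℕ, ENNReal.ofReal (h ((k : ℤ) - ⌊z⌋)) := by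
        refine ENNReal.tsum_le_tsum fun k => ENNReal.ofReal_le_ofReal ?_
        simp only [hh]
        rw [← Real.rpow_add (by norm_num)]
        refine Real.rpow_le_rpow_of_exponent_le (by norm_num) ?_
        push_cast
        have h1 : |(k : ℝ) - ⌊z⌋| ≤ |(k : ℝ) - z| + 1 := by
          have h2 : |z - ⌊z⌋| ≤ 1 := by
            rw [abs_of_nonneg (by linarith [Int.floor_le z])]
            linarith [Int.lt_floor_add_one z]
          calc |(k : ℝ) - ⌊z⌋| = |((k : ℝ) - z) + (z - ⌊z⌋)| := by congr 1; ring
            _ ≤ _ := (abs_add_le _ _).trans (by linarith)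
        nlinarith
    _ ≤ ∑' k : ℤ, ENNReal.ofReal (h (k - ⌊z⌋)) :=
        ENNReal.tsum_comp_le_tsum_of_injective Nat.cast_injective
          fun k : ℤ => ENNReal.ofReal (h (k - ⌊z⌋))
    _ = ∑' k : ℤ, ENNReal.ofReal (h k) :=
        (Equiv.subRight ⌊z⌋).tsum_eq fun k => ENNReal.ofReal (h k)
    _ = ENNReal.ofReal (∑' k, h k) :=
        (ENNReal.ofReal_tsum_of_nonneg (fun k => (hpos k).le) hsum).symm

/-- Used in the critical cases: J comparable terms produce the logarithm, and the tail costs only a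
constant. -/
theorem exists_tsum_le_of_exponential_tail {c : ℝ} (hc : 0 < c) :
    ∃ C : ℝ, 0 < C ∧ ∀ (a : ℕ → ℝ≥0∞) (X Y : ℝ≥0∞) (J : ℕ), (∀ j < J, a j ≤ X) →
      (∀ j, J ≤ j → a j ≤ Y * ENNReal.ofReal (2 ^ (-(c * ((j : ℝ) - J))))) →
      ∑' j, a j ≤ J * X + ENNReal.ofReal C * Y := by
  obtain ⟨C, hC, hCz⟩ := exists_tsum_two_rpow_neg_abs_le hc
  refine ⟨C, hC, fun a X Y J hX hY => ?_⟩
  calc ∑' j, a j ≤ ∑' j : ℕ, ((if j ∈ Finset.range J then X else 0) +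
        Y * ENNReal.ofReal (2 ^ (-(c * |(j : ℝ) - J|)))) := by
        refine ENNReal.tsum_le_tsum fun j => ?_
        by_cases h : j < J
        · rw [if_pos (Finset.mem_range.2 h)]
          exact le_add_right (hX j h)
        · have h' : (J : ℝ) ≤ j := by exact_mod_cast not_lt.1 h
          rw [abs_of_nonneg (by linarith)]
          exact le_add_left (hY j (not_lt.1 h))
    _ ≤ J * X + ENNReal.ofReal C * Y := by
        rw [ENNReal.tsum_add, ENNReal.tsum_mul_left,
          tsum_eq_sum (s := Finset.range J) fun j hj => if_neg hj, Finset.sum_ite_mem,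
          Finset.inter_self, Finset.sum_const, Finset.card_range, nsmul_eq_mul,
          mul_comm (ENNReal.ofReal C)]
        gcongr
        exact hCz J

theorem two_rpow_logb_mul {N : ℕ} (hN : 1 ≤ N) (s : ℝ) :
    (2 : ℝ) ^ (s * Real.logb 2 N) = (N : ℝ) ^ s := by
  have hN0 : (0 : ℝ) < N := by exact_mod_cast hN
  rw [mul_comm, Real.rpow_mul (by norm_num), Real.rpow_logb (by norm_num) (by norm_num) hN0]

theorem logb_natCast_nonneg {N : ℕ} (hN : 1 ≤ N) : 0 ≤ Real.logb 2 N :=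
  Real.logb_nonneg (by norm_num) (by exact_mod_cast hN)

theorem dyadicTerm_le_left {d N : ℕ} {p e : ℝ} {j k : ℕ} {w : ℝ≥0∞}
    (hw : w ≤ ENNReal.ofReal (2 ^ e)) :
    ENNReal.ofReal (2 ^ (((j : ℝ) - k) * p)) * min w (((2 : ℝ≥0∞) ^ d) ^ k / N) ≤
      ENNReal.ofReal (2 ^ (((j : ℝ) - k) * p + e)) := by
  rw [Real.rpow_add (by norm_num), ENNReal.ofReal_mul (by positivity)]
  exact mul_le_mul_right ((min_le_left _ _).trans hw) _

theorem dyadicTerm_le_right {d N : ℕ} (hN : 1 ≤ N) {p : ℝ} {j k : ℕ} {w : ℝ≥0∞} :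
    ENNReal.ofReal (2 ^ (((j : ℝ) - k) * p)) * min w (((2 : ℝ≥0∞) ^ d) ^ k / N) ≤
      ENNReal.ofReal (2 ^ (((j : ℝ) - k) * p + (d * k - Real.logb 2 N))) := by
  have hN0 : (0 : ℝ) < N := by exact_mod_cast hN
  rw [Real.rpow_add (by norm_num), ENNReal.ofReal_mul (by positivity)]
  refine mul_le_mul_right ((min_le_right _ _).trans (le_of_eq ?_)) _
  rw [Real.rpow_sub (by norm_num), Real.rpow_logb (by norm_num) (by norm_num) hN0,
    ENNReal.ofReal_div_of_pos hN0, ENNReal.ofReal_natCast, Real.rpow_mul (by norm_num),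
    Real.rpow_natCast, Real.rpow_natCast, ENNReal.ofReal_pow (by positivity),
    ENNReal.ofReal_pow (by norm_num)]
  simp

/-- Summation over the levels `k` inside one annulus, when `p < d`. -/
theorem exists_tsum_levels_le {d : ℕ} {p : ℝ} (hp : 0 < p) (hpd : p < d) :
    ∃ C : ℝ, 0 < C ∧ ∀ (N : ℕ), 1 ≤ N → ∀ (q : ℝ) (j : ℕ) (w : ℝ≥0∞),
      w ≤ ENNReal.ofReal (2 ^ (-(q * j))) →
      ∑' k : ℕ, ENNReal.ofReal (2 ^ (((j : ℝ) - k) * p)) * min w (((2 : ℝ≥0∞) ^ d) ^ k / N) ≤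
        ENNReal.ofReal C *
          ENNReal.ofReal (2 ^ (-(p / d) * Real.logb 2 N + j * (p - q + q * p / d))) := by
  have hd : (0 : ℝ) < d := hp.trans hpd
  obtain ⟨C, hC, hCz⟩ := exists_tsum_two_rpow_neg_abs_le (lt_min hp (sub_pos.2 hpd))
  refine ⟨C, hC, fun N hN q j w hw => ?_⟩
  set ν := Real.logb 2 N with hν
  -- The real level at which 2^(dk)/N equals 2^(-qj). The terms decay at rate p above it and at rate
  -- d - p below it.
  set z : ℝ := (ν - j * q) / d with hz
  have hzd : z * d = ν - j * q := by rw [hz]; field_simp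
  have hE : -(p / d) * ν + j * (p - q + q * p / d) = j * p - j * q - p * z := by
    rw [hz]; field_simp; ring
  rw [mul_comm]
  refine le_trans ?_ (mul_le_mul_right (hCz z) _)
  rw [← ENNReal.tsum_mul_left]
  refine ENNReal.tsum_le_tsum fun k => ?_
  rw [← ENNReal.ofReal_mul (by positivity), ← Real.rpow_add (by norm_num), hE]
  have hm1 : min p (d - p) ≤ p := min_le_left _ _
  have hm2 : min p (d - p) ≤ d - p := min_le_right _ _
  rcases le_total z k with h | h
  · refine (dyadicTerm_le_left hw).trans (ENNReal.ofReal_le_ofReal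
      (Real.rpow_le_rpow_of_exponent_le (by norm_num) ?_))
    rw [abs_of_nonneg (by linarith)]
    nlinarith [mul_le_mul_of_nonneg_right hm1 (sub_nonneg.2 h)]
  · refine (dyadicTerm_le_right hN).trans (ENNReal.ofReal_le_ofReal
      (Real.rpow_le_rpow_of_exponent_le (by norm_num) ?_))
    rw [abs_of_nonpos (by linarith)]
    nlinarith [mul_le_mul_of_nonneg_right hm2 (sub_nonneg.2 h)]

/-- Summation over the annuli `j` at one level. -/
theorem exists_tsum_annuli_le {d : ℕ} {p q : ℝ} (hp : 0 < p) (hpq : p < q) :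
    ∃ C : ℝ, 0 < C ∧ ∀ (N : ℕ), 1 ≤ N → ∀ (k : ℕ),
      ∑' j : ℕ, ENNReal.ofReal (2 ^ (((j : ℝ) - k) * p)) *
          min (ENNReal.ofReal (2 ^ (-(q * j)))) (((2 : ℝ≥0∞) ^ d) ^ k / N) ≤
        ENNReal.ofReal C *
          ENNReal.ofReal (2 ^ (-(1 - p / q) * Real.logb 2 N + k * (d - p - d * p / q))) := by
  have hq : 0 < q := hp.trans hpq
  obtain ⟨C, hC, hCz⟩ := exists_tsum_two_rpow_neg_abs_le (lt_min hp (sub_pos.2 hpq))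
  refine ⟨C, hC, fun N hN k => ?_⟩
  set ν := Real.logb 2 N with hν
  -- The real annulus index at which 2^(-qj) equals 2^(dk)/N. The terms decay at rate q - p beyond
  -- it and at rate p before it.
  set z : ℝ := (ν - d * k) / q with hz
  have hzd : z * q = ν - d * k := by rw [hz]; field_simp
  have hE : -(1 - p / q) * ν + k * (d - p - d * p / q) = z * p - k * p - z * q := by
    rw [hzd, hz]; field_simp; ring
  rw [mul_comm]
  refine le_trans ?_ (mul_le_mul_right (hCz z) _)
  rw [← ENNReal.tsum_mul_left]
  refine ENNReal.tsum_le_tsum fun j => ?_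
  rw [← ENNReal.ofReal_mul (by positivity), ← Real.rpow_add (by norm_num), hE]
  have hm1 : min p (q - p) ≤ p := min_le_left _ _
  have hm2 : min p (q - p) ≤ q - p := min_le_right _ _
  rcases le_total z j with h | h
  · refine (dyadicTerm_le_left le_rfl).trans (ENNReal.ofReal_le_ofReal
      (Real.rpow_le_rpow_of_exponent_le (by norm_num) ?_))
    rw [abs_of_nonneg (by linarith)]
    nlinarith [mul_le_mul_of_nonneg_right hm2 (sub_nonneg.2 h)]
  · refine (dyadicTerm_le_right hN).trans (ENNReal.ofReal_le_ofReal
      (Real.rpow_le_rpow_of_exponent_le (by norm_num) ?_))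
    rw [abs_of_nonpos (by linarith)]
    nlinarith [mul_le_mul_of_nonneg_right hm1 (sub_nonneg.2 h)]

theorem exists_tsum_geometric_le {s : ℝ} (hs : s < 0) :
    ∃ C : ℝ, 0 < C ∧ ∑' j : ℕ, ENNReal.ofReal (2 ^ (j * s)) ≤ ENNReal.ofReal C := by
  obtain ⟨C, hC, hCz⟩ := exists_tsum_two_rpow_neg_abs_le (neg_pos.2 hs)
  refine ⟨C, hC, le_of_eq_of_le ?_ (hCz 0)⟩
  refine tsum_congr fun j => ?_
  rw [sub_zero, Nat.abs_cast]
  congr 2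
  ring

theorem exists_dyadicSum_le_of_lt {d : ℕ} {p q : ℝ} (hp : 0 < p) (hpd : p < d)
    (h : p / d < 1 - p / q) (hpq : p < q) :
    ∃ C : ℝ, 0 < C ∧ ∀ N : ℕ, 1 ≤ N →
      dyadicSum d N p (fun j => ENNReal.ofReal (2 ^ (-(q * j)))) ≤
        ENNReal.ofReal C * ENNReal.ofReal ((N : ℝ) ^ (-(p / d))) := by
  have hd : (0 : ℝ) < d := hp.trans hpd
  have hq : 0 < q := hp.trans hpq
  have hs : p - q + q * p / d < 0 := by
    have : p - q + q * p / d = q * (p / d - (1 - p / q)) := by field_simp; ring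
    rw [this]
    exact mul_neg_of_pos_of_neg hq (by linarith)
  obtain ⟨C, hC, hCN⟩ := exists_tsum_levels_le hp hpd
  obtain ⟨C', hC', hCs⟩ := exists_tsum_geometric_le hs
  refine ⟨C * C', by positivity, fun N hN => ?_⟩
  refine (ENNReal.tsum_le_tsum fun j => hCN N hN q j _ le_rfl).trans ?_
  simp_rw [Real.rpow_add (two_pos : (0 : ℝ) < 2)]
  simp_rw [ENNReal.ofReal_mul (Real.rpow_nonneg (zero_le_two : (0 : ℝ) ≤ 2) _)]
  rw [ENNReal.tsum_mul_left, ENNReal.tsum_mul_left, two_rpow_logb_mul hN,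
    ENNReal.ofReal_mul hC.le]
  refine (mul_le_mul_right (mul_le_mul_right hCs _) _).trans (le_of_eq ?_)
  ring

theorem exists_dyadicSum_le_of_gt {d : ℕ} (hd : 1 ≤ d) {p q : ℝ} (hp : 0 < p)
    (hpq : p < q) (h : 1 - p / q < p / d) :
    ∃ C : ℝ, 0 < C ∧ ∀ N : ℕ, 1 ≤ N →
      dyadicSum d N p (fun j => ENNReal.ofReal (2 ^ (-(q * j)))) ≤
        ENNReal.ofReal C * ENNReal.ofReal ((N : ℝ) ^ (-(1 - p / q))) := by
  have hd : (0 : ℝ) < d := by exact_mod_cast hd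
  have hq : 0 < q := hp.trans hpq
  have hs : d - p - d * p / q < 0 := by
    have : d - p - d * p / q = d * (1 - p / q - p / d) := by field_simp; ring
    rw [this]
    exact mul_neg_of_pos_of_neg hd (by linarith)
  obtain ⟨C, hC, hCN⟩ := exists_tsum_annuli_le (d := d) hp hpq
  obtain ⟨C', hC', hCs⟩ := exists_tsum_geometric_le hs
  refine ⟨C * C', by positivity, fun N hN => ?_⟩
  unfold dyadicSum
  -- With annuli summed first, no assumption p < d is needed.
  rw [ENNReal.tsum_comm]
  refine (ENNReal.tsum_le_tsum fun k => hCN N hN k).trans ?_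
  simp_rw [Real.rpow_add (two_pos : (0 : ℝ) < 2)]
  simp_rw [ENNReal.ofReal_mul (Real.rpow_nonneg (zero_le_two : (0 : ℝ) ≤ 2) _)]
  rw [ENNReal.tsum_mul_left, ENNReal.tsum_mul_left, two_rpow_logb_mul hN,
    ENNReal.ofReal_mul hC.le]
  refine (mul_le_mul_right (mul_le_mul_right hCs _) _).trans (le_of_eq ?_)
  ring

/-- The ceiling costs an additive 1, absorbed because log(1 + N) ≥ log 2; with log N this would fail
at N = 1. -/
theorem exists_ceil_logb_div_le {q : ℝ} (hq : 0 < q) :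
    ∃ C : ℝ, 0 < C ∧ ∀ N : ℕ, 1 ≤ N →
      (⌈Real.logb 2 N / q⌉₊ : ℝ) ≤ C * Real.log (1 + N) ∧ 1 ≤ C * Real.log (1 + N) := by
  have hl2 : 0 < Real.log 2 := Real.log_pos (by norm_num)
  refine ⟨(1 / q + 1) / Real.log 2, by positivity, fun N hN => ?_⟩
  have hN1 : (1 : ℝ) ≤ N := by exact_mod_cast hN
  have h0 := logb_natCast_nonneg hN
  have h1 : (⌈Real.logb 2 N / q⌉₊ : ℝ) < Real.logb 2 N / q + 1 :=
    Nat.ceil_lt_add_one (by positivity)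
  have h2 : Real.logb 2 N ≤ Real.logb 2 (1 + N) :=
    Real.logb_le_logb_of_le (by norm_num) (by linarith) (by linarith)
  have h3 : 1 ≤ Real.logb 2 (1 + N) := by
    rw [Real.le_logb_iff_rpow_le (by norm_num) (by linarith), Real.rpow_one]
    linarith
  have h4 : (1 / q + 1) / Real.log 2 * Real.log (1 + N) =
      Real.logb 2 (1 + N) / q + Real.logb 2 (1 + N) := by
    unfold Real.logb; field_simp
  have h5 : Real.logb 2 N / q ≤ Real.logb 2 (1 + N) / q := by gcongr
  have h6 : 0 ≤ Real.logb 2 N / q := by positivity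
  rw [h4]
  constructor <;> linarith

theorem natCast_mul_add_le_log {J : ℕ} {C₁ C₂ C₃ l : ℝ} {B : ℝ≥0∞} (hC₁ : 0 ≤ C₁)
    (hC₂ : 0 ≤ C₂) (hC₃ : 0 ≤ C₃)
    (hJ : (J : ℝ) ≤ C₃ * l) (hl : 1 ≤ C₃ * l) :
    J * (ENNReal.ofReal C₁ * B) + ENNReal.ofReal C₂ * B ≤
      ENNReal.ofReal ((C₁ + C₂) * C₃) * (B * ENNReal.ofReal l) := by
  rw [← ENNReal.ofReal_natCast, ← mul_assoc, ← ENNReal.ofReal_mul (by positivity), ← add_mul,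
    ← ENNReal.ofReal_add (by positivity) hC₂, mul_comm B, ← mul_assoc,
    ← ENNReal.ofReal_mul (by positivity)]
  refine mul_le_mul_left (ENNReal.ofReal_le_ofReal ?_) B
  nlinarith [mul_le_mul_of_nonneg_left hJ hC₁, mul_le_mul_of_nonneg_left hl hC₂]

theorem exists_dyadicSum_le_of_eq {d : ℕ} {p q : ℝ} (hp : 0 < p) (hpd : p < d)
    (hpq : p < q) (h : p / d = 1 - p / q) :
    ∃ C : ℝ, 0 < C ∧ ∀ N : ℕ, 1 ≤ N →
      dyadicSum d N p (fun j => ENNReal.ofReal (2 ^ (-(q * j)))) ≤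
        ENNReal.ofReal C *
          (ENNReal.ofReal ((N : ℝ) ^ (-(p / d))) * ENNReal.ofReal (Real.log (1 + N))) := by
  have hd : (0 : ℝ) < d := hp.trans hpd
  have hq : 0 < q := hp.trans hpq
  have hs : p - q + q * p / d = 0 := by
    have : p - q + q * p / d = q * (p / d - (1 - p / q)) := by field_simp; ring
    rw [this, h, sub_self, mul_zero]
  obtain ⟨C₁, hC₁, hlev⟩ := exists_tsum_levels_le hp hpd
  obtain ⟨C₂, hC₂, hgeo⟩ := exists_tsum_geometric_le (neg_neg_of_pos hp)
  obtain ⟨C₃, hC₃, htail⟩ := exists_tsum_le_of_exponential_tail (sub_pos.2 hpq)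
  obtain ⟨C₄, hC₄, hlog⟩ := exists_ceil_logb_div_le hq
  refine ⟨(C₁ + C₃ * C₂) * C₄, by positivity, fun N hN => ?_⟩
  obtain ⟨hJ, hl⟩ := hlog N hN
  -- From annulus J on, the weight 2^(-qj) is at most 1/N. Before J every annulus contributes
  -- N^(-p/d) up to a constant. From J on, bounding the minimum by the weight alone gives a tail of
  -- order 2^(j(p-q)).
  set J := ⌈Real.logb 2 N / q⌉₊ with hJdef
  have hJq : Real.logb 2 N ≤ J * q := by
    rw [← div_le_iff₀ hq]; exact Nat.le_ceil _
  refine le_trans ?_ (natCast_mul_add_le_log hC₁.le (by positivity) hC₄.le hJ hl)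
  rw [ENNReal.ofReal_mul hC₃.le, mul_assoc]
  refine htail _ _ _ J ?_ ?_
  · intro j _
    refine (hlev N hN q j _ le_rfl).trans (le_of_eq ?_)
    rw [hs, mul_zero, add_zero, two_rpow_logb_mul hN]
  · intro j hj
    -- Criticality reads q p/d = q - p, which makes the tail start at height at most N^(-p/d).
    have hbound : ((J : ℝ) * (p - q)) ≤ -(p / d) * Real.logb 2 N := by
      have h1 : (p / d) * q = q - p := by rw [h]; field_simp
      have h2 : 0 ≤ p / d := by positivity
      nlinarith [mul_le_mul_of_nonneg_left hJq h2]
    calc _ ≤ ∑' k : ℕ, ENNReal.ofReal (2 ^ ((k : ℝ) * -p)) *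
          ENNReal.ofReal (2 ^ ((j : ℝ) * (p - q))) := by
          refine ENNReal.tsum_le_tsum fun k => (dyadicTerm_le_left le_rfl).trans (le_of_eq ?_)
          rw [← ENNReal.ofReal_mul (by positivity), ← Real.rpow_add (by norm_num)]
          congr 2
          ring
      _ ≤ ENNReal.ofReal C₂ * (ENNReal.ofReal ((N : ℝ) ^ (-(p / d))) *
          ENNReal.ofReal (2 ^ (-((q - p) * ((j : ℝ) - J))))) := by
          rw [ENNReal.tsum_mul_right, ← two_rpow_logb_mul hN,
            ← ENNReal.ofReal_mul (by positivity), ← Real.rpow_add (by norm_num)]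
          refine mul_le_mul' hgeo (ENNReal.ofReal_le_ofReal
            (Real.rpow_le_rpow_of_exponent_le (by norm_num) ?_))
          linarith
      _ = _ := (mul_assoc _ _ _).symm

/-! ### Estimates of the dyadic sum for q = ∞ -/

/-- The weights of a measure concentrated on the central ball. -/
def centralWeight (j : ℕ) : ℝ≥0∞ := if j = 0 then 1 else 0

theorem dyadicSum_centralWeight (d N : ℕ) (p : ℝ) :
    dyadicSum d N p centralWeight =
      ∑' k : ℕ, ENNReal.ofReal (2 ^ ((((0 : ℕ) : ℝ) - k) * p)) *
        min 1 (((2 : ℝ≥0∞) ^ d) ^ k / N) := by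
  unfold dyadicSum
  rw [tsum_eq_single 0]
  · simp [centralWeight]
  · intro j hj
    simp [centralWeight, hj]

theorem exists_dyadicSum_centralWeight_le_of_lt {d : ℕ} {p : ℝ} (hp : 0 < p) (hpd : p < d) :
    ∃ C : ℝ, 0 < C ∧ ∀ N : ℕ, 1 ≤ N →
      dyadicSum d N p centralWeight ≤
        ENNReal.ofReal C * ENNReal.ofReal ((N : ℝ) ^ (-(p / d))) := by
  obtain ⟨C, hC, hCN⟩ := exists_tsum_levels_le hp hpd
  refine ⟨C, hC, fun N hN => ?_⟩
  rw [dyadicSum_centralWeight]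
  refine (hCN N hN 0 0 1 (by simp)).trans (le_of_eq ?_)
  rw [← two_rpow_logb_mul hN]
  simp

/-- The entry 2^(dk)/N alone suffices: the levels form a geometric series of ratio 2^(d-p). -/
theorem exists_dyadicSum_centralWeight_le_of_gt {d : ℕ} {p : ℝ} (hpd : (d : ℝ) < p) :
    ∃ C : ℝ, 0 < C ∧ ∀ N : ℕ, 1 ≤ N →
      dyadicSum d N p centralWeight ≤ ENNReal.ofReal C * ENNReal.ofReal ((N : ℝ) ^ (-1 : ℝ)) := by
  obtain ⟨C, hC, hgeo⟩ := exists_tsum_geometric_le (sub_neg.2 hpd)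
  refine ⟨C, hC, fun N hN => ?_⟩
  rw [dyadicSum_centralWeight]
  refine le_trans ?_ (mul_le_mul_left hgeo _)
  rw [← ENNReal.tsum_mul_right]
  refine ENNReal.tsum_le_tsum fun k => (dyadicTerm_le_right hN).trans (le_of_eq ?_)
  rw [← two_rpow_logb_mul hN, ← ENNReal.ofReal_mul (by positivity), ← Real.rpow_add (by norm_num)]
  congr 2
  push_cast
  ring

theorem exists_dyadicSum_centralWeight_le_of_eq {d : ℕ} {p : ℝ} (hp : 0 < p) (hpd : (d : ℝ) = p) :
    ∃ C : ℝ, 0 < C ∧ ∀ N : ℕ, 1 ≤ N →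
      dyadicSum d N p centralWeight ≤
        ENNReal.ofReal C *
          (ENNReal.ofReal ((N : ℝ) ^ (-(p / d))) * ENNReal.ofReal (Real.log (1 + N))) := by
  obtain ⟨C₃, hC₃, htail⟩ := exists_tsum_le_of_exponential_tail hp
  obtain ⟨C₄, hC₄, hlog⟩ := exists_ceil_logb_div_le hp
  refine ⟨(1 + C₃) * C₄, by positivity, fun N hN => ?_⟩
  obtain ⟨hJ, hl⟩ := hlog N hN
  -- With d = p every level contributes at most 1/N by cell counting. From level J on, 2^(-kp)
  -- itself is at most 1/N and decays.
  set J := ⌈Real.logb 2 N / p⌉₊ with hJdef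
  have hJq : Real.logb 2 N ≤ J * p := by
    rw [← div_le_iff₀ hp]; exact Nat.le_ceil _
  refine le_trans ?_ (natCast_mul_add_le_log zero_le_one hC₃.le hC₄.le hJ hl)
  rw [dyadicSum_centralWeight, ENNReal.ofReal_one, one_mul, hpd, div_self hp.ne',
    ← two_rpow_logb_mul hN]
  refine htail _ _ _ J ?_ ?_
  · intro k _
    refine (dyadicTerm_le_right hN).trans (le_of_eq ?_)
    congr 2
    rw [hpd]
    push_cast
    ring
  · intro k _
    refine (dyadicTerm_le_left (e := 0) (by simp)).trans ?_
    rw [← ENNReal.ofReal_mul (by positivity), ← Real.rpow_add (by norm_num)]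
    refine ENNReal.ofReal_le_ofReal (Real.rpow_le_rpow_of_exponent_le (by norm_num) ?_)
    push_cast
    nlinarith

/-! ### From moments to annulus masses and quantization bounds -/

theorem measure_radialIndex_le_of_essSup_lt {d : ℕ} {R : ℝ} (hR : 0 < R)
    (μ : Measure (EuclideanSpace ℝ (Fin d))) [IsProbabilityMeasure μ]
    (h : essSup (fun x => ‖x‖ₑ) μ < ENNReal.ofReal R) (j : ℕ) :
    μ {x | radialIndex R x = j} ≤ centralWeight j := by
  unfold centralWeight
  split_ifs with hj
  · exact prob_le_one
  · refine le_of_eq (measure_mono_null (fun x hx => ?_) (ae_iff.1 (ae_lt_of_essSup_lt h)))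
    have hx : radialIndex R x = j := hx
    have h1 := lt_norm_of_lt_radialIndex hR (x := x) (j := 0) (by omega)
    rw [pow_zero, mul_one] at h1
    change ¬ ‖x‖ₑ < ENNReal.ofReal R
    rw [not_lt, ← ofReal_norm]
    exact ENNReal.ofReal_le_ofReal h1.le

/-- Markov's inequality at the inner radius R 2^(j-1) of the annulus; this shift by one is the
source of the factor 2^q. -/
theorem measure_radialIndex_le_of_weakMoment_lt {d : ℕ} {R q : ℝ} (hR : 0 < R) (hq : 0 < q)
    (μ : Measure (EuclideanSpace ℝ (Fin d))) [IsProbabilityMeasure μ]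
    (h : weakMoment q μ ^ (1 / q) < ENNReal.ofReal R) (j : ℕ) :
    μ {x | radialIndex R x = j} ≤
      ENNReal.ofReal (2 ^ q) * ENNReal.ofReal (2 ^ (-(q * j))) := by
  rw [← ENNReal.ofReal_mul (by positivity), ← Real.rpow_add (by norm_num)]
  rcases j with _ | i
  · refine prob_le_one.trans ?_
    rw [ENNReal.one_le_ofReal]
    refine Real.one_le_rpow (by norm_num) ?_
    simp [hq.le]
  have hM : weakMoment q μ ≤ ENNReal.ofReal R ^ q := by
    rw [one_div, ENNReal.rpow_inv_lt_iff hq] at h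
    exact h.le
  have ht : 0 < R * 2 ^ i := by positivity
  have h1 : ENNReal.ofReal (R * 2 ^ i) ^ q * μ {x | R * 2 ^ i ≤ ‖x‖} ≤ ENNReal.ofReal R ^ q := by
    refine le_trans ?_ hM
    have := le_iSup (fun t : ℝ≥0 => (t : ℝ≥0∞) ^ q * μ {x | (t : ℝ) ≤ ‖x‖})
      (Real.toNNReal (R * 2 ^ i))
    rwa [Real.coe_toNNReal _ ht.le] at this
  have h2 : μ {x | radialIndex R x = i + 1} ≤ μ {x | R * 2 ^ i ≤ ‖x‖} := by
    refine measure_mono fun x hx => ?_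
    have hx : radialIndex R x = i + 1 := hx
    exact (lt_norm_of_lt_radialIndex hR (by omega)).le
  refine h2.trans ?_
  rw [ENNReal.ofReal_rpow_of_pos ht, ENNReal.ofReal_rpow_of_pos hR, mul_comm,
    ← ENNReal.le_div_iff_mul_le (Or.inl (by simp; positivity)) (Or.inl ENNReal.ofReal_ne_top),
    ← ENNReal.ofReal_div_of_pos (by positivity)] at h1
  refine h1.trans (ENNReal.ofReal_le_ofReal (le_of_eq ?_))
  rw [Real.mul_rpow hR.le (by positivity), div_mul_cancel_left₀ (by positivity),
    ← Real.rpow_natCast, ← Real.rpow_mul (by norm_num), ← Real.rpow_neg (by norm_num)]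
  congr 1
  push_cast
  ring

/-- A bound on the dyadic sum with weights `w` gives a quantization bound, uniformly over the
measures whose annuli at all scales above `Λ` have masses at most `A * w j`. -/
theorem exists_quantError_le {d : ℕ} (hd : 1 ≤ d) {p : ℝ} (hp : 0 < p) {A C : ℝ} (hA : 1 ≤ A)
    (hC : 0 < C) {w : ℕ → ℝ≥0∞} (hw : ∀ j, w j ≤ 1) {B : ℕ → ℝ} (hB : ∀ N, 1 ≤ N → 0 < B N)
    (hS : ∀ N, 1 ≤ N → dyadicSum d N p w ≤ ENNReal.ofReal C * ENNReal.ofReal (B N)) :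
    ∃ K : ℝ, 0 < K ∧ ∀ N : ℕ, 1 ≤ N → ∀ μ : Measure (EuclideanSpace ℝ (Fin d)),
      IsProbabilityMeasure μ → ∀ Λ : ℝ≥0∞,
      (∀ R : ℝ, 0 < R → Λ < ENNReal.ofReal R →
        ∀ j, μ {x | radialIndex R x = j} ≤ ENNReal.ofReal A * w j) →
      quantError N p μ ≤ ENNReal.ofReal K * Λ * ENNReal.ofReal (B N ^ (1 / p)) := by
  have hA0 : 0 < A := by linarith
  have hd0 : (0 : ℝ) < d := by exact_mod_cast hd
  refine ⟨(2 * (8 * d) ^ p * A * C) ^ (1 / p), by positivity, fun N hN μ hμ Λ hΛ => ?_⟩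
  have hBN := hB N hN
  set K := (2 * (8 * d) ^ p * A * C) ^ (1 / p) with hK
  have hK0 : 0 < K := by positivity
  have hB0 : 0 < B N ^ (1 / p) := by positivity
  -- The radius is taken strictly above Λ and then lowered to it. This covers Λ = 0, where no
  -- positive radius equals Λ.
  have key : ∀ r : ℝ≥0∞, Λ < r →
      quantError N p μ ≤ r * (ENNReal.ofReal K * ENNReal.ofReal (B N ^ (1 / p))) := by
    intro r hr
    rcases eq_or_ne r ∞ with rfl | hrt
    · rw [ENNReal.top_mul]
      · exact le_top
      · rw [← ENNReal.ofReal_mul hK0.le]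
        simp; positivity
    have hR : 0 < r.toReal := ENNReal.toReal_pos (bot_le.trans_lt hr).ne' hrt
    rw [← ENNReal.ofReal_toReal hrt] at hr ⊢
    refine (quantError_le_dyadicSum hd hp hN hR μ (ENNReal.one_le_ofReal.2 hA) hw
      (hΛ _ hR hr)).trans ?_
    refine (ENNReal.rpow_le_rpow (mul_le_mul_right (hS N hN) _) (by positivity)).trans
      (le_of_eq ?_)
    rw [show (2 : ℝ≥0∞) = ENNReal.ofReal 2 by simp, ← ENNReal.ofReal_mul hC.le,
      ← ENNReal.ofReal_mul (by norm_num), ← ENNReal.ofReal_mul (by positivity),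
      ← ENNReal.ofReal_mul (by positivity), ENNReal.ofReal_rpow_of_nonneg (by positivity)
      (by positivity), ← ENNReal.ofReal_mul hK0.le, ← ENNReal.ofReal_mul hR.le]
    congr 1
    rw [Real.mul_rpow (by positivity : (0 : ℝ) ≤ 8 * d) hR.le,
      show 2 * ((8 * (d : ℝ)) ^ p * r.toReal ^ p) * A * (C * B N) =
        r.toReal ^ p * ((2 * (8 * d) ^ p * A * C) * B N) by ring,
      Real.mul_rpow (by positivity) (by positivity), Real.mul_rpow (by positivity) hBN.le,
      ← Real.rpow_mul hR.le, mul_one_div_cancel hp.ne', Real.rpow_one]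
  have hfin : ENNReal.ofReal K * ENNReal.ofReal (B N ^ (1 / p)) ≠ ∞ :=
    ENNReal.mul_ne_top ENNReal.ofReal_ne_top ENNReal.ofReal_ne_top
  have hne : ENNReal.ofReal K * ENNReal.ofReal (B N ^ (1 / p)) ≠ 0 :=
    mul_ne_zero (ENNReal.ofReal_pos.2 hK0).ne' (ENNReal.ofReal_pos.2 hB0).ne'
  have hlim : quantError N p μ ≤
      Λ * (ENNReal.ofReal K * ENNReal.ofReal (B N ^ (1 / p))) := by
    rw [← ENNReal.div_le_iff hne hfin]
    refine le_of_forall_gt_imp_ge_of_dense fun r hr => ?_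
    rw [ENNReal.div_le_iff hne hfin]
    exact key r hr
  refine hlim.trans (le_of_eq ?_)
  ring

theorem natCast_rpow_rpow_one_div {N : ℕ} {p s t : ℝ} (h : s / p = t) :
    ((N : ℝ) ^ s) ^ (1 / p) = (N : ℝ) ^ t := by
  rw [← Real.rpow_mul (Nat.cast_nonneg N), mul_one_div, h]

theorem exists_quantError_le_of_essSup {d : ℕ} (hd : 1 ≤ d) {p : ℝ} (hp : 0 < p) {C : ℝ}
    (hC : 0 < C) {B : ℕ → ℝ} (hB : ∀ N, 1 ≤ N → 0 < B N)
    (hS : ∀ N, 1 ≤ N → dyadicSum d N p centralWeight ≤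
      ENNReal.ofReal C * ENNReal.ofReal (B N)) :
    ∃ K : ℝ, 0 < K ∧ ∀ N : ℕ, 1 ≤ N → ∀ μ : Measure (EuclideanSpace ℝ (Fin d)),
      IsProbabilityMeasure μ →
      quantError N p μ ≤ ENNReal.ofReal K * essSup (fun x => ‖x‖ₑ) μ *
        ENNReal.ofReal (B N ^ (1 / p)) := by
  obtain ⟨K, hK, hKN⟩ := exists_quantError_le hd hp le_rfl hC
    (w := centralWeight) (fun j => by unfold centralWeight; split_ifs <;> simp) hB hS
  refine ⟨K, hK, fun N hN μ hμ => hKN N hN μ hμ _ fun R hR h j => ?_⟩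
  rw [ENNReal.ofReal_one, one_mul]
  exact measure_radialIndex_le_of_essSup_lt hR μ h j

theorem exists_quantError_le_of_weakMoment {d : ℕ} (hd : 1 ≤ d) {p q : ℝ} (hp : 0 < p)
    (hq : 0 < q) {C : ℝ} (hC : 0 < C) {B : ℕ → ℝ} (hB : ∀ N, 1 ≤ N → 0 < B N)
    (hS : ∀ N, 1 ≤ N → dyadicSum d N p (fun j => ENNReal.ofReal (2 ^ (-(q * j)))) ≤
      ENNReal.ofReal C * ENNReal.ofReal (B N)) :
    ∃ K : ℝ, 0 < K ∧ ∀ N : ℕ, 1 ≤ N → ∀ μ : Measure (EuclideanSpace ℝ (Fin d)),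
      IsProbabilityMeasure μ →
      quantError N p μ ≤ ENNReal.ofReal K * weakMoment q μ ^ (1 / q) *
        ENNReal.ofReal (B N ^ (1 / p)) := by
  obtain ⟨K, hK, hKN⟩ := exists_quantError_le hd hp (A := 2 ^ q)
    (Real.one_le_rpow (by norm_num) hq.le) hC
    (w := fun j => ENNReal.ofReal (2 ^ (-(q * j))))
    (fun j => by
      rw [ENNReal.ofReal_le_one]
      refine Real.rpow_le_one_of_one_le_of_nonpos (by norm_num) ?_
      rw [neg_nonpos]; positivity) hB hS
  exact ⟨K, hK, fun N hN μ hμ => hKN N hN μ hμ _ fun R hR h j =>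
    measure_radialIndex_le_of_weakMoment_lt hR hq μ h j⟩

/-! ### Comparison of the two rates and conclusion -/

theorem div_eq_one_sub_div_iff_and_lt {d p q : ℝ} (hd : 0 < d) (hp : 0 < p) (hpq : p < q) :
    (p / d = 1 - p / q ↔ d = p * q / (q - p)) ∧ (p / d ≤ 1 - p / q → p < d) := by
  have hq : 0 < q := hp.trans hpq
  have hqp : 0 < q - p := sub_pos.2 hpq
  constructor
  · rw [eq_div_iff hqp.ne', one_sub_div hq.ne', div_eq_div_iff hd.ne' hq.ne']
    constructor <;> intro h <;> linarith
  · intro h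
    have : p / d < 1 := by
      have : 0 < p / q := by positivity
      linarith
    rwa [div_lt_one hd] at this

theorem theorem2 (d : ℕ) (hd : 1 ≤ d) (p : ℝ) (hp : 0 < p) (q : ℝ≥0∞)
    (hpq : ENNReal.ofReal p < q) :
    ∃ C : ℝ, 0 < C ∧
      ∀ N : ℕ, 1 ≤ N →
        ∀ μ : Measure (EuclideanSpace ℝ (Fin d)), IsProbabilityMeasure μ →
          weakMomentRoot q μ < ∞ →
            ((d : ℝ) ≠ criticalDim p q →
              quantError N p μ ≤ ENNReal.ofReal C * weakMomentRoot q μ *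
                ENNReal.ofReal
                  (max ((N : ℝ) ^ (-(1 / (d : ℝ)))) ((N : ℝ) ^ (-(1 / p) + (1 / q).toReal)))) ∧
            ((d : ℝ) = criticalDim p q →
              quantError N p μ ≤ ENNReal.ofReal C * weakMomentRoot q μ *
                ENNReal.ofReal
                  ((N : ℝ) ^ (-(1 / (d : ℝ))) * Real.log (1 + (N : ℝ)) ^ (1 / p))) := by
  have hd0 : (0 : ℝ) < d := by exact_mod_cast hd
  have hpow : ∀ (s : ℝ) (N : ℕ), 1 ≤ N → 0 < (N : ℝ) ^ s := fun s N hN =>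
    Real.rpow_pos_of_pos (by exact_mod_cast hN) s
  have hlogpos : ∀ N : ℕ, 1 ≤ N → 0 < Real.log (1 + (N : ℝ)) := fun N hN =>
    Real.log_pos (by have : (0 : ℝ) < N := by exact_mod_cast hN
                     linarith)
  have hexp : -(p / (d : ℝ)) / p = -(1 / (d : ℝ)) := by field_simp
  have hcrit : ∀ N : ℕ, 1 ≤ N →
      ((N : ℝ) ^ (-(p / (d : ℝ))) * Real.log (1 + (N : ℝ))) ^ (1 / p) =
        (N : ℝ) ^ (-(1 / (d : ℝ))) * Real.log (1 + (N : ℝ)) ^ (1 / p) := fun N hN => by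
    rw [Real.mul_rpow (hpow _ N hN).le (hlogpos N hN).le, natCast_rpow_rpow_one_div hexp]
  rcases eq_or_ne q ∞ with rfl | hqt
  · simp only [weakMomentRoot, criticalDim, if_true]
    rcases lt_trichotomy (d : ℝ) p with h | h | h
    · obtain ⟨C, hC, hS⟩ := exists_dyadicSum_centralWeight_le_of_gt h
      obtain ⟨K, hK, hKN⟩ := exists_quantError_le_of_essSup hd hp hC (hpow _) hS
      refine ⟨K, hK, fun N hN μ hμ _ => ⟨fun _ => ?_, fun h' => absurd h' h.ne⟩⟩
      refine (hKN N hN μ hμ).trans (mul_le_mul_right (ENNReal.ofReal_le_ofReal ?_) _)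
      rw [natCast_rpow_rpow_one_div (t := -(1 / p) + (1 / (∞ : ℝ≥0∞)).toReal)
        (by simp; field_simp)]
      exact le_max_right _ _
    · obtain ⟨C, hC, hS⟩ := exists_dyadicSum_centralWeight_le_of_eq hp h
      obtain ⟨K, hK, hKN⟩ := exists_quantError_le_of_essSup hd hp hC
        (B := fun N => (N : ℝ) ^ (-(p / (d : ℝ))) * Real.log (1 + (N : ℝ)))
        (fun N hN => mul_pos (hpow _ N hN) (hlogpos N hN))
        (fun N hN => by rw [ENNReal.ofReal_mul (hpow _ N hN).le]; exact hS N hN)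
      refine ⟨K, hK, fun N hN μ hμ _ => ⟨fun h' => absurd h h', fun _ => ?_⟩⟩
      rw [← hcrit N hN]
      exact hKN N hN μ hμ
    · obtain ⟨C, hC, hS⟩ := exists_dyadicSum_centralWeight_le_of_lt hp h
      obtain ⟨K, hK, hKN⟩ := exists_quantError_le_of_essSup hd hp hC (hpow _) hS
      refine ⟨K, hK, fun N hN μ hμ _ => ⟨fun _ => ?_, fun h' => absurd h' h.ne'⟩⟩
      refine (hKN N hN μ hμ).trans (mul_le_mul_right (ENNReal.ofReal_le_ofReal ?_) _)
      rw [natCast_rpow_rpow_one_div hexp]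
      exact le_max_left _ _
  · have hpQ : p < q.toReal := (ENNReal.ofReal_lt_iff_lt_toReal hp.le hqt).1 hpq
    have hQ : 0 < q.toReal := hp.trans hpQ
    simp only [weakMomentRoot, criticalDim, if_neg hqt]
    obtain ⟨hiff, hlt⟩ := div_eq_one_sub_div_iff_and_lt hd0 hp hpQ
    -- The exponents p/d and 1 - p/q of the p-th power of the error decide which order of summation
    -- is used; equality is the critical dimension.
    rcases lt_trichotomy (p / (d : ℝ)) (1 - p / q.toReal) with h | h | h
    · obtain ⟨C, hC, hS⟩ := exists_dyadicSum_le_of_lt hp (hlt h.le) h hpQ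
      obtain ⟨K, hK, hKN⟩ := exists_quantError_le_of_weakMoment hd hp hQ hC (hpow _) hS
      refine ⟨K, hK, fun N hN μ hμ _ => ⟨fun _ => ?_, fun h' => absurd (hiff.2 h') h.ne⟩⟩
      refine (hKN N hN μ hμ).trans (mul_le_mul_right (ENNReal.ofReal_le_ofReal ?_) _)
      rw [natCast_rpow_rpow_one_div hexp]
      exact le_max_left _ _
    · obtain ⟨C, hC, hS⟩ := exists_dyadicSum_le_of_eq hp (hlt h.le) hpQ h
      obtain ⟨K, hK, hKN⟩ := exists_quantError_le_of_weakMoment hd hp hQ hC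
        (B := fun N => (N : ℝ) ^ (-(p / (d : ℝ))) * Real.log (1 + (N : ℝ)))
        (fun N hN => mul_pos (hpow _ N hN) (hlogpos N hN))
        (fun N hN => by rw [ENNReal.ofReal_mul (hpow _ N hN).le]; exact hS N hN)
      refine ⟨K, hK, fun N hN μ hμ _ => ⟨fun h' => absurd (hiff.1 h) h', fun _ => ?_⟩⟩
      rw [← hcrit N hN]
      exact hKN N hN μ hμ
    · obtain ⟨C, hC, hS⟩ := exists_dyadicSum_le_of_gt hd hp hpQ h
      obtain ⟨K, hK, hKN⟩ := exists_quantError_le_of_weakMoment hd hp hQ hC (hpow _) hS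
      refine ⟨K, hK, fun N hN μ hμ _ => ⟨fun _ => ?_, fun h' => absurd (hiff.2 h') h.ne'⟩⟩
      refine (hKN N hN μ hμ).trans (mul_le_mul_right (ENNReal.ofReal_le_ofReal ?_) _)
      rw [natCast_rpow_rpow_one_div (t := -(1 / p) + (1 / q).toReal)
        (by rw [one_div, one_div, ENNReal.toReal_inv]; field_simp; ring)]
      exact le_max_right _ _
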